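/- For a positive integer $\ell$ and an integer $n\ge 0$, let $b_\ell(n)$ denote the number of $\ell$-regular partitions of $n$, i.e. partitions of $n$ none of whose parts is divisible by $\ell$ (so $b_\ell(0)=1$), and set $b_\ell(n)=0$ for $n<0$. Let $\alpha,n$ be nonnegative integers and let $p_1,\dots,p_{\alpha+1}$ be primes (not necessarily distinct) such that $b_{25}(p_i-1)\equiv 0\pmod 5$ for every $1\le i\le\alpha+1$. Then for every integer $j\not\equiv 0\pmod{p_{\alpha+1}}$, $$b_{25}\left(p_1^2\cdots p_{\alpha+1}^2\,n+p_1^2\cdots p_{\alpha}^2\,p_{\alpha+1}(j+p_{\alpha+1})-1\right)\equiv 0\pmod 5,$$ where for $\alpha=0$ the empty product $p_1^2\cdots p_\alpha^2$ equals $1$. -/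

import Mathlib

/-- The number `b_ℓ(n)` of `ℓ`-regular partitions of `n`, i.e. partitions of `n` none of whose
parts is divisible by `ℓ`; it is `0` for negative `n`. -/
def regularPartitionCount (ℓ : ℕ) (n : ℤ) : ℕ :=
  if 0 ≤ n then (Nat.Partition.restricted n.toNat (fun i => ¬ ℓ ∣ i)).card else 0

/-!
Write `F = ∏ (1 - X ^ n)` and `θ = X * d/dX`. Modulo `5` the generating series of `b₂₅` is `F ^ 24`,
and the key congruence is `X * F ^ 24 ≡ θ (∑ σ(n) X ^ n)`, that is, `b₂₅(N - 1) ≡ N * σ(N)`.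

Logarithmic differentiation gives `θ F = -F * ∑ σ(n) X ^ n`, hence
`(θ F) ^ 2 - F * θ (θ F) = F ^ 2 * θ (∑ σ(n) X ^ n)`, so it suffices that the left-hand side is
`X * F ^ 26`. By Euler's pentagonal number theorem the coefficients of both at `X ^ N` are signed
sums over the pairs `(k, l)` whose pentagonal numbers add up to `N`. Modulo `5`, the difference of
the two sums, once symmetrised in `k` and `l`, is the signed count of the pairs with
`k ≡ 2 * l - 1` plus that of the pairs with `l ≡ 2 * k - 1`, and a sign-reversing reflection shows
that each count vanishes.

If a prime `q` occurs in `N` to an odd power, then `q ∣ N` and `σ(q) = q + 1 ∣ σ(N)`, so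
`5 ∣ q * σ(q)` forces `5 ∣ N * σ(N)`.
-/

open PowerSeries
open scoped ArithmeticFunction.sigma PowerSeries.WithPiTopology

section RegularPartitions

theorem geom_sum_char_pow {R : Type*} [CommRing R] (p k : ℕ) [Fact p.Prime] [CharP R p] (y : R) :
    ∑ j ∈ Finset.range (p ^ k), y ^ j = (1 - y) ^ (p ^ k - 1) := by
  -- The identity is universal: in the domain `(ZMod p)[X]` one may cancel `1 - X`.
  have hX : ∑ j ∈ Finset.range (p ^ k), (Polynomial.X : Polynomial (ZMod p)) ^ j =
      (1 - Polynomial.X) ^ (p ^ k - 1) := by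
    have hne : (1 : Polynomial (ZMod p)) ≠ Polynomial.X := (Polynomial.X_ne_C 1).symm
    refine mul_right_cancel₀ (sub_ne_zero.mpr hne) ?_
    rw [geom_sum_mul_neg, ← pow_succ, Nat.sub_add_cancel (Nat.pow_pos (Fact.out : p.Prime).pos),
      sub_pow_char_pow, one_pow]
  let _ : Algebra (ZMod p) R := ZMod.algebra R p
  simpa using congrArg (Polynomial.aeval y) hX

theorem mk_card_restricted_prime_pow (R : Type*) [CommRing R] (p k : ℕ) [Fact p.Prime] [CharP R p] :
    PowerSeries.mk (fun n ↦ ((Nat.Partition.restricted n (¬ p ^ k ∣ ·)).card : R)) =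
      pentagonalSeries R ^ (p ^ k - 1) := by
  have hpos : 0 < p ^ k := Nat.pow_pos (Fact.out : p.Prime).pos
  let _ : TopologicalSpace R := ⊥
  have _ : DiscreteTopology R := ⟨rfl⟩
  have _ : CharP R⟦X⟧ p := charP_of_injective_algebraMap (R := R) (A := R⟦X⟧) C_injective p
  simp_rw [Nat.Partition.card_restricted_eq_card_countRestricted _ hpos]
  have hsum := Nat.Partition.hasProd_powerSeriesMk_card_countRestricted R hpos
  have hpow := (WithPiTopology.hasProd_one_sub_X_pow R).map
    (powMonoidHom (p ^ k - 1) : R⟦X⟧ →* R⟦X⟧) (continuous_pow _)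
  have hfactor : (fun i ↦ ∑ j ∈ Finset.range (p ^ k), (X : R⟦X⟧) ^ ((i + 1) * j)) =
      powMonoidHom (p ^ k - 1) ∘ fun i ↦ 1 - X ^ (i + 1) := by
    ext1 i
    simp only [pow_mul, Function.comp_apply, powMonoidHom_apply, geom_sum_char_pow]
  exact (hfactor ▸ hsum).unique hpow

end RegularPartitions

section LogarithmicDerivative

theorem derivation_prod_eq_sum_mul {R A ι : Type*} [CommSemiring R] [CommSemiring A]
    [Algebra R A] (D : Derivation R A A) {f g : ι → A} (h : ∀ i, D (f i) = g i * f i)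
    (s : Finset ι) :
    D (∏ i ∈ s, f i) = (∑ i ∈ s, g i) * ∏ i ∈ s, f i := by
  classical
  induction s using Finset.induction_on with
  | empty => simp
  | insert i s hi ih =>
    rw [Finset.prod_insert hi, Finset.sum_insert hi, D.leibniz, ih, h, smul_eq_mul, smul_eq_mul]
    ring

theorem derivation_eq_mul_of_hasProd {R A ι : Type*} [CommSemiring R] [CommSemiring A] [Algebra R A]
    [TopologicalSpace A] [T2Space A] [ContinuousMul A] {D : Derivation R A A} (hD : Continuous D)
    {f g : ι → A} {F G : A} (h : ∀ i, D (f i) = g i * f i) (hf : HasProd f F) (hg : HasSum g G) :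
    D F = G * F := by
  refine tendsto_nhds_unique ((hD.tendsto F).comp hf) ?_
  simpa only [Function.comp_def, derivation_prod_eq_sum_mul D h] using Filter.Tendsto.mul hg hf

theorem sq_derivation_sub_mul {R A : Type*} [CommSemiring R] [CommRing A] [Algebra R A]
    (D : Derivation R A A) {f g : A} (h : D f = g * f) :
    D f ^ 2 - f * D (D f) = -(f ^ 2 * D g) := by
  have hDD : D (D f) = g * D f + f * D g := by
    rw [congrArg D h, D.leibniz, smul_eq_mul, smul_eq_mul]
  rw [hDD, h]
  ring

variable (R : Type*) [CommRing R]

/-- The Euler operator `X * d/dX` on formal power series. -/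
noncomputable def eulerDerivation : Derivation R R⟦X⟧ R⟦X⟧ := (X : R⟦X⟧) • d⁄dX R

/-- The generating series `∑ σ(n) X ^ n` of the sum-of-divisors function. -/
noncomputable def sigmaSeries : R⟦X⟧ := .mk fun n ↦ (σ 1 n : R)

variable {R}

theorem coeff_eulerDerivation (f : R⟦X⟧) (n : ℕ) :
    coeff n (eulerDerivation R f) = n * coeff n f := by
  cases n with
  | zero => simp [eulerDerivation]
  | succ n => simp [eulerDerivation, coeff_succ_X_mul, coeff_derivative, mul_comm]

theorem eulerDerivation_one_sub_X_pow (i : ℕ) :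
    eulerDerivation R (1 - X ^ (i + 1)) =
      -(((i + 1 : ℕ) : R⟦X⟧) * expand (i + 1) i.succ_ne_zero (X * PowerSeries.mk 1)) *
        (1 - X ^ (i + 1)) := by
  have hgeom : expand (i + 1) i.succ_ne_zero (X * PowerSeries.mk 1) * (1 - X ^ (i + 1) : R⟦X⟧) =
      X ^ (i + 1) := by
    have hmap :=
      congrArg (fun f ↦ expand (i + 1) i.succ_ne_zero (X * f)) (mk_one_mul_one_sub_eq_one R)
    simpa [← mul_assoc] using hmap
  have hderiv : eulerDerivation R (1 - X ^ (i + 1)) = -(((i + 1 : ℕ) : R⟦X⟧) * X ^ (i + 1)) := by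
    rw [eulerDerivation, Derivation.smul_apply, map_sub, Derivation.map_one_eq_zero,
      Derivation.leibniz_pow, derivative_X, smul_eq_mul, smul_eq_mul, nsmul_eq_mul,
      Nat.add_sub_cancel]
    ring
  rw [hderiv, neg_mul, mul_assoc, hgeom]

theorem continuous_eulerDerivation [TopologicalSpace R] [ContinuousMul R] :
    Continuous (eulerDerivation R) := by
  refine continuous_iff_continuousAt.mpr fun f ↦ ?_
  refine (WithPiTopology.tendsto_iff_coeff_tendsto _ _ _ _).mpr fun n ↦ ?_
  simp only [coeff_eulerDerivation]
  exact ((WithPiTopology.continuous_coeff R n).tendsto f).const_mul _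

theorem hasSum_sigmaSeries [TopologicalSpace R] :
    HasSum (fun i : ℕ ↦ ((i + 1 : ℕ) : R⟦X⟧) *
      expand (i + 1) i.succ_ne_zero (X * PowerSeries.mk 1)) (sigmaSeries R) := by
  refine (WithPiTopology.hasSum_iff_hasSum_coeff R).mpr fun n ↦ ?_
  have hcoeff (i : ℕ) : coeff n (((i + 1 : ℕ) : R⟦X⟧) *
      expand (i + 1) i.succ_ne_zero (X * PowerSeries.mk 1)) =
        if i + 1 ∈ n.divisors then ((i + 1 : ℕ) : R) else 0 := by
    rw [← map_natCast (C (R := R)), coeff_C_mul, coeff_expand]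
    cases n with
    | zero => simp
    | succ n =>
      split_ifs with hd hn hn
      · obtain ⟨m, hm⟩ := hd
        cases m with
        | zero => simp at hm
        | succ m => simp [hm, coeff_succ_X_mul]
      · simp [hd] at hn
      · simp [hd] at hn
      · simp
  have hsum : coeff n (sigmaSeries R) =
      ∑ i ∈ Finset.range n, if i + 1 ∈ n.divisors then ((i + 1 : ℕ) : R) else 0 := by
    rw [sigmaSeries, coeff_mk, ArithmeticFunction.sigma_one_apply, Nat.divisors, Nat.cast_sum,
      Finset.sum_filter, Finset.sum_Ico_eq_sum_range]
    refine Finset.sum_congr rfl fun i hi ↦ ?_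
    simp [add_comm 1 i, Finset.mem_range.mp hi]
  rw [hsum]
  simp only [hcoeff]
  refine hasSum_sum_of_ne_finset_zero fun i hi ↦ if_neg fun h ↦ hi ?_
  exact Finset.mem_range.mpr (Nat.divisor_le h)

theorem eulerDerivation_pentagonalSeries :
    eulerDerivation R (pentagonalSeries R) = -sigmaSeries R * pentagonalSeries R := by
  let _ : TopologicalSpace R := ⊥
  have _ : DiscreteTopology R := ⟨rfl⟩
  have hsum := (hasSum_sigmaSeries (R := R)).neg
  exact derivation_eq_mul_of_hasProd continuous_eulerDerivation eulerDerivation_one_sub_X_pow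
    (WithPiTopology.hasProd_one_sub_X_pow R) hsum

end LogarithmicDerivative

section PentagonalTheta

variable {R : Type*} [CommRing R]

/-- The lacunary series `∑ a k * X ^ pentagonal k`, indexed by `k : ℤ`. -/
noncomputable def pentagonalTheta (a : ℤ → R) : R⟦X⟧ := .mk (Function.extend pentagonal a 0)

/-- The pairs of integers whose pentagonal numbers add up to `N`. -/
noncomputable def pentagonalPairs (N : ℕ) : Finset (ℤ × ℤ) :=
  (Finset.HasAntidiagonal.antidiagonal N).preimage (Prod.map pentagonal pentagonal)
    (pentagonal_injective.prodMap pentagonal_injective).injOn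

theorem mem_pentagonalPairs {N : ℕ} {kl : ℤ × ℤ} :
    kl ∈ pentagonalPairs N ↔ pentagonal kl.1 + pentagonal kl.2 = N := by
  simp [pentagonalPairs]

theorem coeff_pentagonal_pentagonalTheta (a : ℤ → R) (k : ℤ) :
    coeff (pentagonal k) (pentagonalTheta a) = a k := by
  simp [pentagonalTheta, pentagonal_injective.extend_apply]

theorem coeff_pentagonalTheta_eq_zero (a : ℤ → R) {n : ℕ} (hn : n ∉ Set.range pentagonal) :
    coeff n (pentagonalTheta a) = 0 := by
  simp [pentagonalTheta, Function.extend_apply' _ _ _ hn]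

theorem eq_pentagonalTheta {f : R⟦X⟧} {a : ℤ → R} (hf : ∀ n ∉ Set.range pentagonal, coeff n f = 0)
    (ha : ∀ k, coeff (pentagonal k) f = a k) : f = pentagonalTheta a := by
  ext n
  by_cases hn : n ∈ Set.range pentagonal
  · obtain ⟨k, rfl⟩ := hn
    rw [ha, coeff_pentagonal_pentagonalTheta]
  · rw [hf n hn, coeff_pentagonalTheta_eq_zero a hn]

theorem pentagonalSeries_eq_pentagonalTheta :
    pentagonalSeries R = pentagonalTheta fun k ↦ (k.negOnePow : R) :=
  eq_pentagonalTheta (fun _ ↦ coeff_pentagonalSeries_eq_zero R)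
    (coeff_pentagonalSeries_pentagonal R)

theorem eulerDerivation_pentagonalTheta (a : ℤ → R) :
    eulerDerivation R (pentagonalTheta a) = pentagonalTheta fun k ↦ pentagonal k * a k := by
  refine eq_pentagonalTheta (fun n hn ↦ ?_) fun k ↦ ?_
  · rw [coeff_eulerDerivation, coeff_pentagonalTheta_eq_zero a hn, mul_zero]
  · rw [coeff_eulerDerivation, coeff_pentagonal_pentagonalTheta]

theorem coeff_pentagonalTheta_mul (a b : ℤ → R) (N : ℕ) :
    coeff N (pentagonalTheta a * pentagonalTheta b) =
      ∑ kl ∈ pentagonalPairs N, a kl.1 * b kl.2 := by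
  have hzero (x : ℕ × ℕ) (hx : x ∉ Set.range (Prod.map pentagonal pentagonal)) :
      coeff x.1 (pentagonalTheta a) * coeff x.2 (pentagonalTheta b) = 0 := by
    rw [Set.range_prodMap, Set.mem_prod, not_and_or] at hx
    rcases hx with h | h <;> simp [coeff_pentagonalTheta_eq_zero _ h]
  rw [coeff_mul, ← Finset.sum_preimage _ _
    (pentagonal_injective.prodMap pentagonal_injective).injOn _ fun x _ ↦ hzero x]
  simp [pentagonalPairs, coeff_pentagonal_pentagonalTheta]

theorem sum_pentagonalPairs_swap {M : Type*} [AddCommMonoid M] (g : ℤ × ℤ → M) (N : ℕ) :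
    ∑ kl ∈ pentagonalPairs N, g kl.swap = ∑ kl ∈ pentagonalPairs N, g kl :=
  Finset.sum_equiv (Equiv.prodComm ℤ ℤ) (by simp [mem_pentagonalPairs, add_comm]) (by simp)

end PentagonalTheta

section ModFive

instance fact_prime_five : Fact (Nat.Prime 5) := ⟨Nat.prime_five⟩

theorem natCast_pentagonal_zmod_five (k : ℤ) :
    (pentagonal k : ZMod 5) = k * (2 - k) := by
  have h := congrArg (Int.cast (R := ZMod 5)) (two_mul_natCast_pentagonal k)
  push_cast at h
  have h5 : (5 : ZMod 5) = 0 := rfl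
  linear_combination 3 * h + h5 * (-(pentagonal k : ZMod 5) + 2 * k ^ 2 - k)

theorem pentagonal_one_sub_five_mul (k : ℤ) :
    pentagonal (1 - 5 * k) = 25 * pentagonal k + 1 := by
  zify
  linarith [two_mul_natCast_pentagonal (1 - 5 * k), two_mul_natCast_pentagonal k]

theorem intCast_zmod_five_eq_one_iff {k : ℤ} : (k : ZMod 5) = 1 ↔ ∃ m, k = 1 - 5 * m := by
  rw [← Int.cast_one, ZMod.intCast_eq_intCast_iff_dvd_sub]
  constructor <;> rintro ⟨m, hm⟩ <;> exact ⟨m, by push_cast at *; linarith⟩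

theorem negOnePow_one_sub_five_mul (m : ℤ) : (1 - 5 * m).negOnePow = -m.negOnePow := by
  rw [show 1 - 5 * m = 2 * (-3 * m) + m + 1 by ring, Int.negOnePow_succ, Int.negOnePow_add,
    Int.negOnePow_two_mul, one_mul]

theorem pow_char_pow_eq_expand (p n : ℕ) [Fact p.Prime] (f : (ZMod p)⟦X⟧) :
    f ^ p ^ n = expand (p ^ n) (pow_ne_zero n (NeZero.ne p)) f := by
  have h := MvPowerSeries.map_iterateFrobenius_expand p (NeZero.ne p) f n
  rw [Subsingleton.elim (iterateFrobenius (ZMod p) p n) (RingHom.id _), MvPowerSeries.map_id] at h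
  exact h.symm

theorem X_mul_pentagonalSeries_pow_twentyFive :
    X * pentagonalSeries (ZMod 5) ^ 25 =
      pentagonalTheta fun k ↦ if (k : ZMod 5) = 1 then -(k.negOnePow : ZMod 5) else 0 := by
  have hne {n : ℕ} (hn : n ∉ pentagonal '' {k | (k : ZMod 5) = 1}) :
      coeff n (X * pentagonalSeries (ZMod 5) ^ 5 ^ 2) = 0 := by
    cases n with
    | zero => simp
    | succ n =>
      rw [coeff_succ_X_mul, pow_char_pow_eq_expand, coeff_expand]
      split_ifs with hd
      · obtain ⟨m, rfl⟩ := hd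
        rw [Nat.mul_div_cancel_left _ (by norm_num)]
        refine coeff_pentagonalSeries_eq_zero _ ?_
        rintro ⟨k, rfl⟩
        exact hn ⟨1 - 5 * k, intCast_zmod_five_eq_one_iff.mpr ⟨k, rfl⟩,
          pentagonal_one_sub_five_mul k⟩
      · rfl
  refine eq_pentagonalTheta (fun n hn ↦ hne fun h ↦ hn (Set.image_subset_range _ _ h)) fun k ↦ ?_
  split_ifs with hk
  · obtain ⟨m, rfl⟩ := intCast_zmod_five_eq_one_iff.mp hk
    rw [pentagonal_one_sub_five_mul, coeff_succ_X_mul]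
    change coeff (5 ^ 2 * pentagonal m) (pentagonalSeries (ZMod 5) ^ 5 ^ 2) = _
    rw [pow_char_pow_eq_expand, coeff_expand_mul, coeff_pentagonalSeries_pentagonal,
      negOnePow_one_sub_five_mul]
    simp
  · exact hne fun h ↦ hk (pentagonal_injective.mem_set_image.mp h)

/-- On the pairs `(2 * l - 1 + 5 * m, l)`, the reflection of `l` about `(1 - 4 * m) / 2` with `m`
fixed. As `pentagonal (2 * l - 1 + 5 * m) + pentagonal l` is a quadratic polynomial in `l` with
vertex `(1 - 4 * m) / 2`, the reflection preserves the sum of the pentagonal numbers. The integer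
quotient `m` is exact on these pairs only. -/
def vertexReflection (kl : ℤ × ℤ) : ℤ × ℤ :=
  (1 - 2 * kl.2 - 3 * ((kl.1 - 2 * kl.2 + 1) / 5), 1 - kl.2 - 4 * ((kl.1 - 2 * kl.2 + 1) / 5))

theorem vertexReflection_apply (l m : ℤ) :
    vertexReflection (2 * l - 1 + 5 * m, l) =
      (2 * (1 - l - 4 * m) - 1 + 5 * m, 1 - l - 4 * m) := by
  have h : (2 * l - 1 + 5 * m - 2 * l + 1) / 5 = m := by omega
  simp only [vertexReflection, h, Prod.mk.injEq, and_true]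
  ring

theorem intCast_zmod_five_eq_two_mul_sub_one_iff {k l : ℤ} :
    (k : ZMod 5) = 2 * l - 1 ↔ ∃ m, k = 2 * l - 1 + 5 * m := by
  rw [show (2 * l - 1 : ZMod 5) = (2 * l - 1 : ℤ) by push_cast; rfl, eq_comm,
    ZMod.intCast_eq_intCast_iff_dvd_sub]
  exact exists_congr fun m ↦ by constructor <;> intro h <;> push_cast at * <;> linarith

theorem pentagonal_add_pentagonal_reflect (l m : ℤ) :
    pentagonal (2 * (1 - l - 4 * m) - 1 + 5 * m) + pentagonal (1 - l - 4 * m) =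
      pentagonal (2 * l - 1 + 5 * m) + pentagonal l := by
  zify
  linarith [two_mul_natCast_pentagonal (2 * (1 - l - 4 * m) - 1 + 5 * m),
    two_mul_natCast_pentagonal (1 - l - 4 * m), two_mul_natCast_pentagonal (2 * l - 1 + 5 * m),
    two_mul_natCast_pentagonal l]

theorem negOnePow_reflect (l m : ℤ) :
    ((2 * (1 - l - 4 * m) - 1 + 5 * m) + (1 - l - 4 * m)).negOnePow =
      -((2 * l - 1 + 5 * m) + l).negOnePow := by
  rw [← Int.negOnePow_succ, Int.negOnePow_eq_iff]
  exact ⟨1 - 3 * l - 6 * m, by ring⟩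

theorem sum_negOnePow_pentagonalPairs (R : Type*) [Ring R] (N : ℕ) :
    ∑ kl ∈ pentagonalPairs N with (kl.1 : ZMod 5) = 2 * kl.2 - 1,
      ((kl.1 + kl.2).negOnePow : R) = 0 := by
  have hpair {kl : ℤ × ℤ} (h : kl ∈ (pentagonalPairs N).filter fun kl ↦
      (kl.1 : ZMod 5) = 2 * kl.2 - 1) : ∃ l m, kl = (2 * l - 1 + 5 * m, l) := by
    obtain ⟨m, hm⟩ := intCast_zmod_five_eq_two_mul_sub_one_iff.mp (Finset.mem_filter.mp h).2
    exact ⟨kl.2, m, Prod.ext hm rfl⟩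
  refine Finset.sum_involution (fun kl _ ↦ vertexReflection kl) ?_ ?_ ?_ ?_
  · intro kl h
    obtain ⟨l, m, rfl⟩ := hpair h
    rw [vertexReflection_apply, negOnePow_reflect]
    simp
  · intro kl h _
    obtain ⟨l, m, rfl⟩ := hpair h
    rw [vertexReflection_apply, Ne, Prod.mk.injEq]
    omega
  · intro kl h
    obtain ⟨l, m, rfl⟩ := hpair h
    rw [Finset.mem_filter, mem_pentagonalPairs] at h ⊢
    rw [vertexReflection_apply]
    exact ⟨(pentagonal_add_pentagonal_reflect l m).trans h.1,
      intCast_zmod_five_eq_two_mul_sub_one_iff.mpr ⟨m, rfl⟩⟩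
  · intro kl h
    obtain ⟨l, m, rfl⟩ := hpair h
    rw [vertexReflection_apply, vertexReflection_apply]
    congr 1 <;> ring

theorem indicator_add_indicator_sub_sq_zmod_five (x y : ZMod 5) :
    (if x = 1 then 1 else 0) + (if y = 1 then 1 else 0) - (x * (2 - x) - y * (2 - y)) ^ 2 =
      (if x = 2 * y - 1 then 1 else 0) + if y = 2 * x - 1 then 1 else 0 := by
  decide +revert

theorem sum_negOnePow_mul_pentagonal_sub_eq_zero (N : ℕ) :
    ∑ kl ∈ pentagonalPairs N, ((kl.1 + kl.2).negOnePow : ZMod 5) *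
      (pentagonal kl.1 * pentagonal kl.2 - (pentagonal kl.2 : ZMod 5) ^ 2 +
        if (kl.1 : ZMod 5) = 1 then 1 else 0) = 0 := by
  set f : ℤ × ℤ → ZMod 5 := fun kl ↦ ((kl.1 + kl.2).negOnePow : ZMod 5) *
    (pentagonal kl.1 * pentagonal kl.2 - (pentagonal kl.2 : ZMod 5) ^ 2 +
      if (kl.1 : ZMod 5) = 1 then 1 else 0)
  set g : ℤ × ℤ → ZMod 5 := fun kl ↦
    ((kl.1 + kl.2).negOnePow : ZMod 5) * if (kl.1 : ZMod 5) = 2 * kl.2 - 1 then 1 else 0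
  have hg : ∑ kl ∈ pentagonalPairs N, g kl = 0 := by
    simpa only [g, mul_ite, mul_one, mul_zero, Finset.sum_filter] using
      sum_negOnePow_pentagonalPairs (ZMod 5) N
  have hfg (kl : ℤ × ℤ) : f kl + f kl.swap = g kl + g kl.swap := by
    simp only [f, g, Prod.fst_swap, Prod.snd_swap, add_comm kl.2 kl.1, natCast_pentagonal_zmod_five]
    linear_combination ((kl.1 + kl.2).negOnePow : ZMod 5) *
      indicator_add_indicator_sub_sq_zmod_five kl.1 kl.2
  have htwo : 2 * ∑ kl ∈ pentagonalPairs N, f kl = 0 := by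
    calc 2 * ∑ kl ∈ pentagonalPairs N, f kl
        = ∑ kl ∈ pentagonalPairs N, (f kl + f kl.swap) := by
          rw [Finset.sum_add_distrib, sum_pentagonalPairs_swap, two_mul]
      _ = 0 := by
          simp only [hfg, Finset.sum_add_distrib, sum_pentagonalPairs_swap, hg, add_zero]
  exact (mul_eq_zero.mp htwo).resolve_left (by decide)

theorem sq_eulerDerivation_pentagonalSeries_sub :
    eulerDerivation (ZMod 5) (pentagonalSeries (ZMod 5)) ^ 2 - pentagonalSeries (ZMod 5) *
        eulerDerivation (ZMod 5) (eulerDerivation (ZMod 5) (pentagonalSeries (ZMod 5))) =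
      X * pentagonalSeries (ZMod 5) ^ 25 * pentagonalSeries (ZMod 5) := by
  rw [X_mul_pentagonalSeries_pow_twentyFive]
  simp only [pentagonalSeries_eq_pentagonalTheta, eulerDerivation_pentagonalTheta]
  ext N
  rw [← sub_eq_zero, map_sub, sq]
  simp only [coeff_pentagonalTheta_mul, ← Finset.sum_sub_distrib]
  refine Eq.trans ?_ (sum_negOnePow_mul_pentagonal_sub_eq_zero N)
  refine Finset.sum_congr rfl fun kl _ ↦ ?_
  rw [Int.negOnePow_add]
  split_ifs <;> push_cast <;> ring

theorem X_mul_pentagonalSeries_pow_twentyFour :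
    X * pentagonalSeries (ZMod 5) ^ 24 = eulerDerivation (ZMod 5) (sigmaSeries (ZMod 5)) := by
  have hne : pentagonalSeries (ZMod 5) ≠ 0 := fun h ↦ by
    simpa [h] using coeff_pentagonalSeries_pentagonal (ZMod 5) 0
  refine mul_left_cancel₀ (pow_ne_zero 2 hne) ?_
  have hlog := sq_derivation_sub_mul (eulerDerivation (ZMod 5))
    (eulerDerivation_pentagonalSeries (R := ZMod 5))
  rw [sq_eulerDerivation_pentagonalSeries_sub, map_neg, mul_neg, neg_neg] at hlog
  rw [← hlog]
  ring

theorem natCast_regularPartitionCount_twentyFive (N : ℕ) :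
    (regularPartitionCount 25 ((N : ℤ) - 1) : ZMod 5) = N * σ 1 N := by
  have h := congrArg (coeff N) X_mul_pentagonalSeries_pow_twentyFour
  rw [show 24 = 5 ^ 2 - 1 by norm_num, ← mk_card_restricted_prime_pow (ZMod 5) 5 2,
    coeff_eulerDerivation, sigmaSeries, coeff_mk] at h
  cases N with
  | zero => simp [regularPartitionCount]
  | succ n =>
    rw [Nat.cast_succ, add_sub_cancel_right]
    simpa [regularPartitionCount, coeff_succ_X_mul] using h

end ModFive

section Divisibility

theorem add_one_dvd_sigma_one_of_odd_factorization {p N : ℕ} (hp : p.Prime)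
    (h : Odd (N.factorization p)) : p + 1 ∣ σ 1 N := by
  have hN : N ≠ 0 := by
    rintro rfl
    simp at h
  rw [← Nat.ordProj_mul_ordCompl_eq_self N p,
    ArithmeticFunction.isMultiplicative_sigma.map_mul_of_coprime
      ((Nat.coprime_ordCompl hp hN).pow_left _),
    ArithmeticFunction.sigma_one_apply_prime_pow hp]
  refine Dvd.dvd.mul_right ?_ _
  have hp1 : (p : ZMod (p + 1)) = -1 :=
    eq_neg_of_add_eq_zero_left (by exact_mod_cast ZMod.natCast_self (p + 1))
  rw [← ZMod.natCast_eq_zero_iff]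
  push_cast
  rw [hp1, neg_one_geom_sum, if_pos h.add_one]

theorem regularPartitionCount_modEq_zero_of_odd_factorization {q N : ℕ} (hq : q.Prime)
    (hb : regularPartitionCount 25 ((q : ℤ) - 1) ≡ 0 [MOD 5]) (h : Odd (N.factorization q)) :
    regularPartitionCount 25 ((N : ℤ) - 1) ≡ 0 [MOD 5] := by
  rw [Nat.modEq_zero_iff_dvd, ← ZMod.natCast_eq_zero_iff,
    natCast_regularPartitionCount_twentyFive, mul_eq_zero] at hb ⊢
  have hσ : σ 1 q = q + 1 := by
    simpa [Finset.sum_range_succ, add_comm] using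
      ArithmeticFunction.sigma_one_apply_prime_pow (i := 1) hq
  simp only [ZMod.natCast_eq_zero_iff, hσ] at hb ⊢
  exact hb.imp (fun h5 ↦ h5.trans (Nat.dvd_of_factorization_pos h.pos.ne'))
    fun h5 ↦ h5.trans (add_one_dvd_sigma_one_of_odd_factorization hq h)

theorem odd_factorization_sq_mul_self_mul {P q M : ℕ} (hq : q.Prime) (hP : P ≠ 0) (hM : ¬ q ∣ M) :
    Odd ((P ^ 2 * q * M).factorization q) := by
  have hM0 : M ≠ 0 := by
    rintro rfl
    simp at hM
  rw [Nat.factorization_mul (by simp [hP, hq.ne_zero]) hM0,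
    Nat.factorization_mul (by simp [hP]) hq.ne_zero, Nat.factorization_pow]
  simp [hq.factorization_self, Nat.factorization_eq_zero_of_not_dvd hM]

end Divisibility

theorem theorem1p4_general {q : ℕ} (hq : q.Prime)
    (hb : regularPartitionCount 25 ((q : ℤ) - 1) ≡ 0 [MOD 5]) (P n : ℤ) {j : ℤ}
    (hj : ¬ j ≡ 0 [ZMOD q]) :
    regularPartitionCount 25 (P ^ 2 * q ^ 2 * n + P ^ 2 * q * (j + q) - 1) ≡ 0 [MOD 5] := by
  have hM : ¬ (q : ℤ) ∣ q * n + j + q := by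
    rw [dvd_add_self_right, dvd_add_right (dvd_mul_right _ _)]
    exact fun h ↦ hj (Int.modEq_zero_iff_dvd.mpr h)
  have harg : P ^ 2 * q ^ 2 * n + P ^ 2 * q * (j + q) = P ^ 2 * q * (q * n + j + q) := by ring
  rw [harg]
  generalize q * n + j + q = M at hM
  rcases le_or_gt (P ^ 2 * q * M) 0 with hneg | hpos
  · rw [regularPartitionCount, if_neg (by linarith)]
  · have hP : P ≠ 0 := by
      rintro rfl
      simp at hpos
    have hq0 : 0 < q := hq.pos
    lift M to ℕ using ((mul_pos_iff_of_pos_left (by positivity)).mp hpos).le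
    rw [← Int.natAbs_sq P]
    exact_mod_cast regularPartitionCount_modEq_zero_of_odd_factorization hq hb
      (odd_factorization_sq_mul_self_mul hq (Int.natAbs_ne_zero.mpr hP) (by exact_mod_cast hM))

theorem theorem1p4 (α n : ℕ) (p : Fin (α + 1) → ℕ) (hp : ∀ i, (p i).Prime)
    (hb : ∀ i, regularPartitionCount 25 ((p i : ℤ) - 1) ≡ 0 [MOD 5])
    (j : ℤ) (hj : ¬ j ≡ 0 [ZMOD (p (Fin.last α) : ℤ)]) :
    regularPartitionCount 25
        ((∏ i : Fin (α + 1), (p i : ℤ) ^ 2) * (n : ℤ)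
          + (∏ i : Fin α, (p i.castSucc : ℤ) ^ 2) * (p (Fin.last α) : ℤ)
            * (j + (p (Fin.last α) : ℤ)) - 1) ≡ 0 [MOD 5] := by
  rw [Fin.prod_univ_castSucc, Finset.prod_pow]
  exact theorem1p4_general (hp _) (hb _) (∏ i : Fin α, (p i.castSucc : ℤ)) n hj
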